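/- Let $\mathsf{Prop}$ be an infinite set of propositional variables, and let formulas be built from $\bot$ and variables by $\wedge,\vee,\to$. An intermediate logic is a set of formulas that contains the theorems of the intuitionistic propositional calculus $\mathsf{IPC}$ and is closed under modus ponens and substitution. It is axiomatizable by $\Phi$-formulas, for a class $\Phi$ of formulas, if it is the least intermediate logic containing some (possibly infinite) set $\Gamma\subseteq\Phi$. A frame $(W,R,\mathcal P)$ is a nonempty partial order $(W,R)$ with a Heyting subalgebra $\mathcal P$ of its algebra of upsets. It is a Kripke frame if $\mathcal P$ consists of all upsets, and a descriptive frame if it is refined (if not $wRv$, then some $U\in\mathcal P$ contains $w$ but not $v$) and compact (every subfamily of $\mathcal P\cup\{W\setminus U: U\in\mathcal P\}$ with the finite intersection property has nonempty intersection). A formula is valid on a frame if it is true at all points under all valuations with values in $\mathcal P$. A frame $(W',R',\mathcal P')$ is a subframe of $(W,R,\mathcal P)$, both being Kripke or both descriptive, if $W'\subseteq W$, $R'=R\restriction W'$ and, in the descriptive case, $\mathcal P'=\{U\cap W': U\in\mathcal P\}$ and $W\setminus R^{-1}(W'\setminus U)\in\mathcal P$ for every $U\in\mathcal P'$. An intermediate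 logic $L$ is a subframe logic if the class of (Kripke or descriptive) frames validating all formulas of $L$ is closed under subframes. Consider the following classes of formulas. * $\mathsf{NNIL}$: the formulas in which no antecedent of an implication contains an implication. * $\mathsf{MR}$: the formulas $\varphi$ such that, for all Kripke models $\mathfrak N,\mathfrak M$ (with persistent valuations), every order-preserving map $f:\mathfrak N\to\mathfrak M$ for which $w$ and $f(w)$ always satisfy the same variables, and every point $w$ of $\mathfrak N$, if $\mathfrak M,f(w)\models\varphi$ then $\mathfrak N,w\models\varphi$. * $\mathsf B$: the formulas $\beta(w)$, for $w$ a point of a finite Kripke model in a finite set of variables, where $\mathit{prop}(w)$ and $\mathit{notprop}(w)$ are the sets of those of these variables that are true, respectively not true, at $w$, and $$\beta(w)=\bigwedge \mathit{prop}(w)\to\bigvee \mathit{notprop}(w)$$ if $w$ is maximal, and $$\beta(w)=\bigwedge \mathit{prop}(w)\to\bigvee \mathit{notprop}(w)\vee\bigvee_{i=1}^k\beta(w_i)$$ if $w$ is not maximal and $w_1,\dots,w_k$ are its immediate successors. Here $\bigvee\emptyset=\bot$, an empty conjunction in front of an implication is dropped, and finite conjunctions and disjunctions may be taken in any order. **Corollary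 4.10.** For an intermediate logic $L$ the following are equivalent: 1. $L$ is axiomatizable by $\mathsf B$-formulas; 2. $L$ is axiomatizable by $\mathsf{NNIL}$-formulas; 3. $L$ is axiomatizable by $\mathsf{MR}$-formulas; 4. $L$ is a subframe logic. -/

import Mathlib

universe u

/-- Formulas of intuitionistic propositional logic over a set `α` of propositional variables. -/
inductive Formula (α : Type u) : Type u
  | bot : Formula α
  | var (p : α) : Formula α
  | and (φ ψ : Formula α) : Formula α
  | or (φ ψ : Formula α) : Formula α
  | imp (φ ψ : Formula α) : Formula α

namespace Formula

variable {α : Type u}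

/-- Uniform substitution of formulas for variables. -/
def subst (σ : α → Formula α) : Formula α → Formula α
  | bot => bot
  | var p => σ p
  | and φ ψ => and (subst σ φ) (subst σ ψ)
  | or φ ψ => or (subst σ φ) (subst σ ψ)
  | imp φ ψ => imp (subst σ φ) (subst σ ψ)

/-- Finite disjunction; the empty one is `⊥`. -/
def bigOr : List (Formula α) → Formula α
  | [] => bot
  | [φ] => φ
  | φ :: ψ :: l => or φ (bigOr (ψ :: l))

/-- Conjunction of the nonempty list `φ :: l`. -/
def bigAnd : Formula α → List (Formula α) → Formula α
  | φ, [] => φ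
  | φ, ψ :: l => and φ (bigAnd ψ l)

/-- `⋀ l → χ`. The language has no constant for truth: an empty conjunction in front of an
implication is dropped, i.e. `⋀ ∅ → χ` is `χ`. -/
def bigAndImp : List (Formula α) → Formula α → Formula α
  | [], χ => χ
  | φ :: l, χ => imp (bigAnd φ l) χ

end Formula

section Logics

variable {α : Type u}

open Formula

/-- The theorems of the intuitionistic propositional calculus (a Hilbert system). -/
inductive IPC : Formula α → Prop
  | k (φ ψ : Formula α) : IPC (imp φ (imp ψ φ))
  | s (φ ψ χ : Formula α) :
      IPC (imp (imp φ (imp ψ χ)) (imp (imp φ ψ) (imp φ χ)))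
  | andLeft (φ ψ : Formula α) : IPC (imp (and φ ψ) φ)
  | andRight (φ ψ : Formula α) : IPC (imp (and φ ψ) ψ)
  | andIntro (φ ψ : Formula α) : IPC (imp φ (imp ψ (and φ ψ)))
  | orLeft (φ ψ : Formula α) : IPC (imp φ (or φ ψ))
  | orRight (φ ψ : Formula α) : IPC (imp ψ (or φ ψ))
  | orElim (φ ψ χ : Formula α) :
      IPC (imp (imp φ χ) (imp (imp ψ χ) (imp (or φ ψ) χ)))
  | exFalso (φ : Formula α) : IPC (imp bot φ)
  | mp (φ ψ : Formula α) : IPC (imp φ ψ) → IPC φ → IPC ψ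

/-- An intermediate logic: a set of formulas that contains `IPC` and is closed under modus ponens
and substitution. -/
structure IsIntermediateLogic (L : Set (Formula α)) : Prop where
  ipc_mem : ∀ φ, IPC φ → φ ∈ L
  mp_mem : ∀ φ ψ, imp φ ψ ∈ L → φ ∈ L → ψ ∈ L
  subst_mem : ∀ (σ : α → Formula α) φ, φ ∈ L → subst σ φ ∈ L

/-- `L` is axiomatizable by `Φ`-formulas: it is the least intermediate logic containing some
(possibly infinite) set `Γ ⊆ Φ`. -/
def AxiomatizableBy (Φ L : Set (Formula α)) : Prop :=
  ∃ Γ ⊆ Φ, IsLeast {L' : Set (Formula α) | IsIntermediateLogic L' ∧ Γ ⊆ L'} L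

end Logics

section Semantics

variable {α : Type u}

/-- Kripke satisfaction at a point of the model with order `≤` and valuation `V`. -/
def Sat {W : Type u} [PartialOrder W] (V : α → Set W) : W → Formula α → Prop
  | _, .bot => False
  | w, .var p => w ∈ V p
  | w, .and φ ψ => Sat V w φ ∧ Sat V w ψ
  | w, .or φ ψ => Sat V w φ ∨ Sat V w ψ
  | w, .imp φ ψ => ∀ v, w ≤ v → Sat V v φ → Sat V v ψ

/-- A valuation is persistent if all its values are upsets. -/
def Persistent {W : Type u} [PartialOrder W] (V : α → Set W) : Prop :=
  ∀ p, IsUpperSet (V p)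

/-- An intuitionistic general frame: a nonempty partial order together with a Heyting subalgebra
`Adm` of its algebra of upsets. -/
structure GeneralFrame : Type (u + 1) where
  World : Type u
  order : PartialOrder World
  nonempty : Nonempty World
  Adm : Set (Set World)
  upper : ∀ A ∈ Adm, IsUpperSet A
  empty_mem : ∅ ∈ Adm
  univ_mem : Set.univ ∈ Adm
  inter_mem : ∀ A ∈ Adm, ∀ B ∈ Adm, A ∩ B ∈ Adm
  union_mem : ∀ A ∈ Adm, ∀ B ∈ Adm, A ∪ B ∈ Adm
  himp_mem : ∀ A ∈ Adm, ∀ B ∈ Adm, {w | ∀ v, w ≤ v → v ∈ A → v ∈ B} ∈ Adm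

attribute [instance] GeneralFrame.order GeneralFrame.nonempty

namespace GeneralFrame

/-- Kripke frames: all upsets are admissible. -/
def IsKripke (F : GeneralFrame.{u}) : Prop :=
  ∀ A : Set F.World, IsUpperSet A → A ∈ F.Adm

/-- Descriptive frames: refined and compact general frames. -/
structure IsDescriptive (F : GeneralFrame.{u}) : Prop where
  refined : ∀ w v : F.World, ¬ w ≤ v → ∃ A ∈ F.Adm, w ∈ A ∧ v ∉ A
  compact : ∀ X ⊆ F.Adm, ∀ Y ⊆ F.Adm,
    (∀ X₀ ⊆ X, ∀ Y₀ ⊆ Y, X₀.Finite → Y₀.Finite →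
      ∃ w, (∀ A ∈ X₀, w ∈ A) ∧ ∀ B ∈ Y₀, w ∉ B) →
    ∃ w, (∀ A ∈ X, w ∈ A) ∧ ∀ B ∈ Y, w ∉ B

/-- A formula is valid on a frame if it is true at every point under every admissible valuation. -/
def Validates (F : GeneralFrame.{u}) (φ : Formula α) : Prop :=
  ∀ V : α → Set F.World, (∀ p, V p ∈ F.Adm) → ∀ w, Sat V w φ

/-- `F'` is, up to isomorphism, a subframe of `F`: along an order embedding `e`, the admissible
sets of `F'` are the traces of those of `F`, and the topo-subframe condition holds: for every
`A ∈ Adm F'` the set `W ∖ R⁻¹(W' ∖ A)` is in `Adm F`. When `F` and `F'` are Kripke frames the last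
two conditions hold automatically. -/
def IsSubframe (F' F : GeneralFrame.{u}) : Prop :=
  ∃ e : F'.World ↪o F.World,
    F'.Adm = {A' | ∃ A ∈ F.Adm, A' = e ⁻¹' A} ∧
    ∀ A' ∈ F'.Adm, {w | ∃ v, v ∉ A' ∧ w ≤ e v}ᶜ ∈ F.Adm

end GeneralFrame

/-- Subframe logics: the intermediate logics whose class of (Kripke or descriptive) frames is
closed under subframes. -/
def IsSubframeLogic (L : Set (Formula α)) : Prop :=
  IsIntermediateLogic L ∧
    ∀ F F' : GeneralFrame.{u},
      (F.IsKripke ∧ F'.IsKripke ∨ F.IsDescriptive ∧ F'.IsDescriptive) →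
      F'.IsSubframe F → (∀ φ ∈ L, F.Validates φ) → ∀ φ ∈ L, F'.Validates φ

end Semantics

section Classes

variable {α : Type u}

open Formula

/-- Formulas without implications. -/
inductive ImpFree : Formula α → Prop
  | bot : ImpFree bot
  | var (p : α) : ImpFree (var p)
  | and (φ ψ : Formula α) : ImpFree φ → ImpFree ψ → ImpFree (and φ ψ)
  | or (φ ψ : Formula α) : ImpFree φ → ImpFree ψ → ImpFree (or φ ψ)

/-- Formulas with no nesting of implications to the left: antecedents contain no implication. -/
inductive IsNNIL : Formula α → Prop
  | bot : IsNNIL bot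
  | var (p : α) : IsNNIL (var p)
  | and (φ ψ : Formula α) : IsNNIL φ → IsNNIL ψ → IsNNIL (and φ ψ)
  | or (φ ψ : Formula α) : IsNNIL φ → IsNNIL ψ → IsNNIL (or φ ψ)
  | imp (φ ψ : Formula α) : ImpFree φ → IsNNIL ψ → IsNNIL (imp φ ψ)

/-- Monotonically reflective formulas: those reflected by all order and color preserving maps
between models. -/
def IsMR (φ : Formula α) : Prop :=
  ∀ (W W' : Type u) [PartialOrder W] [PartialOrder W'] (V : α → Set W) (V' : α → Set W'),
    Persistent V → Persistent V' →
    ∀ f : W → W', Monotone f → (∀ p w, w ∈ V p ↔ f w ∈ V' p) →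
      ∀ w, Sat V' (f w) φ → Sat V w φ

/-- `IsBeta vars V w φ`: the formula `φ` is a subframe formula `β(w)` of the point `w`, in the finite
set `vars` of variables. Each use of a constructor picks an order in which the finite sets
`prop(w)`, `notprop(w)` and that of the immediate successors of `w` are listed; `b v` is the
formula `β(v)` already defined for an immediate successor `v`. -/
inductive IsBeta {W : Type u} [PartialOrder W] (vars : Finset α) (V : α → Set W) :
    W → Formula α → Prop
  | maximal (w : W) (ps qs : List α)
      (hps : ps.Nodup ∧ ∀ p, p ∈ ps ↔ p ∈ vars ∧ w ∈ V p)
      (hqs : qs.Nodup ∧ ∀ p, p ∈ qs ↔ p ∈ vars ∧ w ∉ V p)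
      (hmax : IsMax w) :
      IsBeta vars V w (bigAndImp (ps.map var) (bigOr (qs.map var)))
  | notMaximal (w : W) (ps qs : List α) (ws : List W) (b : W → Formula α)
      (hps : ps.Nodup ∧ ∀ p, p ∈ ps ↔ p ∈ vars ∧ w ∈ V p)
      (hqs : qs.Nodup ∧ ∀ p, p ∈ qs ↔ p ∈ vars ∧ w ∉ V p)
      (hws : ws.Nodup ∧ ∀ v, v ∈ ws ↔ w ⋖ v)
      (hmax : ¬ IsMax w)
      (hb : ∀ v ∈ ws, IsBeta vars V v (b v)) :
      IsBeta vars V w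
        (bigAndImp (ps.map var) (or (bigOr (qs.map var)) (bigOr (ws.map b))))

/-- The class `B`: all `β(w)` for a point `w` of a finite model in finitely many variables. -/
def BFormulas (α : Type u) : Set (Formula α) :=
  {φ | ∃ (vars : Finset α) (W : Type u) (_ : PartialOrder W) (_ : Finite W) (V : α → Set W)
    (w : W), Persistent V ∧ IsBeta vars V w φ}

end Classes

/-! The syntactic inclusions give `B` ⊆ NNIL ⊆ MR, and an MR-formula valid on a frame stays valid on
its subframes because the embedding preserves order and colours. Hence a logic axiomatized by
MR-formulas is a subframe logic.

The substance is that a subframe logic `L` is axiomatized by its own `B`-formulas. Let `L'` contain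
these and suppose `φ ∈ L` but `φ ∉ L'`. Completeness refutes `φ` on a descriptive frame of `L'`.
Selecting witnesses for refuted implications gives a finite poset `T` with a monotone map into that
frame. Give each subformula of `φ` its own variable and colour `T` accordingly. The formula `β` of
its root is then refuted on the frame, so `β ∉ L'` and therefore `β ∉ L`.

Now refute `β` on a descriptive frame of `L`. Refuting `β` means that the coloured poset can be
traced in the frame (`IsBeta.not_sat_iff`). The points that trace some element of `T` form a finite
union of differences of admissible sets, hence a descriptive subframe, which validates `L`. There
the colours satisfy a truth lemma, so `φ` is refuted, contradicting `φ ∈ L`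
(`IsSubframeLogic.notMem_of_isBeta_notMem`). -/

open Formula

/-! ### Kripke semantics: persistence and soundness -/

section SatLemmas

variable {α W : Type u} [PartialOrder W] {V : α → Set W}

theorem Persistent.sat_mono (hV : Persistent V) {φ : Formula α} {w v : W} (hwv : w ≤ v)
    (h : Sat V w φ) : Sat V v φ := by
  induction φ with
  | bot => exact h
  | var p => exact hV p hwv h
  | and φ ψ ihφ ihψ => exact ⟨ihφ h.1, ihψ h.2⟩
  | or φ ψ ihφ ihψ => exact h.imp ihφ ihψ
  | imp φ ψ _ _ => exact fun u hu => h u (hwv.trans hu)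

theorem sat_subst (σ : α → Formula α) (φ : Formula α) (w : W) :
    Sat V w (subst σ φ) ↔ Sat (fun p => {v | Sat V v (σ p)}) w φ := by
  induction φ generalizing w with
  | bot => exact Iff.rfl
  | var p => exact Iff.rfl
  | and φ ψ ihφ ihψ => exact and_congr (ihφ w) (ihψ w)
  | or φ ψ ihφ ihψ => exact or_congr (ihφ w) (ihψ w)
  | imp φ ψ ihφ ihψ =>
    exact forall_congr' fun v => imp_congr_right fun _ => imp_congr (ihφ v) (ihψ v)

theorem Persistent.sat_of_ipc (hV : Persistent V) {φ : Formula α} (h : IPC φ) (w : W) :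
    Sat V w φ := by
  induction h generalizing w with
  | k φ ψ => exact fun v _ hv u hu _ => hV.sat_mono hu hv
  | s φ ψ χ =>
    exact fun v _ h₁ u hu h₂ x hx h₃ => h₁ x (hu.trans hx) h₃ x le_rfl (h₂ x hx h₃)
  | andLeft φ ψ => exact fun v _ h => h.1
  | andRight φ ψ => exact fun v _ h => h.2
  | andIntro φ ψ => exact fun v _ hv u hu h => ⟨hV.sat_mono hu hv, h⟩
  | orLeft φ ψ => exact fun v _ h => Or.inl h
  | orRight φ ψ => exact fun v _ h => Or.inr h
  | orElim φ ψ χ =>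
    exact fun v _ h₁ u hu h₂ x hx h => h.elim (h₁ x (hu.trans hx)) (h₂ x hx)
  | exFalso φ => exact fun v _ h => h.elim
  | mp φ ψ _ _ ih₁ ih₂ => exact ih₁ w w le_rfl (ih₂ w)

theorem sat_bigOr {l : List (Formula α)} {w : W} :
    Sat V w (bigOr l) ↔ ∃ φ ∈ l, Sat V w φ := by
  induction l with
  | nil => simp [bigOr, Sat]
  | cons φ l ih =>
    cases l with
    | nil => simp [bigOr]
    | cons ψ l => simp only [bigOr, Sat, ih, List.mem_cons, exists_eq_or_imp]

theorem sat_bigAnd {φ : Formula α} {l : List (Formula α)} {w : W} :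
    Sat V w (bigAnd φ l) ↔ ∀ ψ ∈ φ :: l, Sat V w ψ := by
  induction l generalizing φ with
  | nil => simp [bigAnd]
  | cons ψ l ih => rw [bigAnd, Sat, ih, List.forall_mem_cons (a := φ)]

theorem Persistent.sat_bigAndImp (hV : Persistent V) {l : List (Formula α)} {χ : Formula α}
    {w : W} :
    Sat V w (bigAndImp l χ) ↔ ∀ v, w ≤ v → (∀ φ ∈ l, Sat V v φ) → Sat V v χ := by
  cases l with
  | nil => exact ⟨fun h v hv _ => hV.sat_mono hv h, fun h => h w le_rfl (by simp)⟩
  | cons φ l => simp only [bigAndImp, Sat, sat_bigAnd]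

end SatLemmas

/-! ### General frames and their restrictions -/

namespace GeneralFrame

variable {α : Type u} (F : GeneralFrame.{u})

theorem persistent {V : α → Set F.World} (hV : ∀ p, V p ∈ F.Adm) : Persistent V :=
  fun p => F.upper _ (hV p)

theorem sat_mem_adm {V : α → Set F.World} (hV : ∀ p, V p ∈ F.Adm) (φ : Formula α) :
    {w | Sat V w φ} ∈ F.Adm := by
  induction φ with
  | bot => exact F.empty_mem
  | var p => exact hV p
  | and φ ψ ihφ ihψ => exact F.inter_mem _ ihφ _ ihψ
  | or φ ψ ihφ ihψ => exact F.union_mem _ ihφ _ ihψ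
  | imp φ ψ ihφ ihψ => exact F.himp_mem _ ihφ _ ihψ

theorem isIntermediateLogic_validates :
    IsIntermediateLogic {φ : Formula α | F.Validates φ} where
  ipc_mem _ h _ hV w := (F.persistent hV).sat_of_ipc h w
  mp_mem _ _ h₁ h₂ _ hV w := h₁ _ hV w w le_rfl (h₂ _ hV w)
  subst_mem σ φ h _ hV w := (sat_subst σ φ w).2 (h _ (fun p => F.sat_mem_adm hV (σ p)) w)

variable {F}

theorem iInter_mem_adm {ι : Type*} [Finite ι] {A : ι → Set F.World}
    (hA : ∀ i, A i ∈ F.Adm) : ⋂ i, A i ∈ F.Adm := by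
  have h : ∀ s : Set ι, s.Finite → ⋂ i ∈ s, A i ∈ F.Adm := by
    intro s hs
    induction s, hs using Set.Finite.induction_on with
    | empty => simpa using F.univ_mem
    | insert _ _ ih => rw [Set.biInter_insert]; exact F.inter_mem _ (hA _) _ ih
  simpa using h Set.univ Set.finite_univ

theorem iUnion_mem_adm {ι : Type*} [Finite ι] {A : ι → Set F.World}
    (hA : ∀ i, A i ∈ F.Adm) : ⋃ i, A i ∈ F.Adm := by
  have h : ∀ s : Set ι, s.Finite → ⋃ i ∈ s, A i ∈ F.Adm := by
    intro s hs
    induction s, hs using Set.Finite.induction_on with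
    | empty => simpa using F.empty_mem
    | insert _ _ ih => rw [Set.biUnion_insert]; exact F.union_mem _ (hA _) _ ih
  simpa using h Set.univ Set.finite_univ

variable (F)

/-- The frame induced on a nonempty set `S` of worlds, provided that the admissible sets are closed
under the implication relativized to `S`. -/
def restrict (S : Set F.World) (hne : S.Nonempty)
    (hS : ∀ A ∈ F.Adm, ∀ B ∈ F.Adm, {w | ∀ v, w ≤ v → v ∈ S → v ∈ A → v ∈ B} ∈ F.Adm) :
    GeneralFrame.{u} where
  World := S
  order := inferInstance
  nonempty := hne.to_subtype
  Adm := {A' | ∃ A ∈ F.Adm, A' = (↑) ⁻¹' A}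
  upper := by
    rintro _ ⟨A, hA, rfl⟩ w v hwv hw
    exact F.upper A hA hwv hw
  empty_mem := ⟨∅, F.empty_mem, rfl⟩
  univ_mem := ⟨Set.univ, F.univ_mem, rfl⟩
  inter_mem := by
    rintro _ ⟨A, hA, rfl⟩ _ ⟨B, hB, rfl⟩
    exact ⟨A ∩ B, F.inter_mem A hA B hB, rfl⟩
  union_mem := by
    rintro _ ⟨A, hA, rfl⟩ _ ⟨B, hB, rfl⟩
    exact ⟨A ∪ B, F.union_mem A hA B hB, rfl⟩
  himp_mem := by
    rintro _ ⟨A, hA, rfl⟩ _ ⟨B, hB, rfl⟩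
    refine ⟨_, hS A hA B hB, ?_⟩
    ext w
    exact ⟨fun h v hwv hv => h ⟨v, hv⟩ hwv, fun h v hwv => h v hwv v.2⟩

theorem restrict_isSubframe (S : Set F.World) (hne : S.Nonempty)
    (hS : ∀ A ∈ F.Adm, ∀ B ∈ F.Adm, {w | ∀ v, w ≤ v → v ∈ S → v ∈ A → v ∈ B} ∈ F.Adm) :
    (F.restrict S hne hS).IsSubframe F := by
  refine ⟨OrderEmbedding.subtype (· ∈ S), rfl, ?_⟩
  rintro _ ⟨A, hA, rfl⟩
  -- The topo-subframe condition is the relativized implication with the whole frame as antecedent.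
  convert hS _ F.univ_mem A hA using 1
  ext w
  simp only [Set.mem_compl_iff, Set.mem_ofPred_eq, not_exists, not_and', Set.mem_univ, true_imp_iff]
  exact ⟨fun h v hwv hv => not_not.1 (h ⟨v, hv⟩ hwv), fun h v hwv => not_not.2 (h v.1 hwv v.2)⟩

variable {F}

/-- Each piece `C i \ D i` inherits compactness. If the whole family has empty intersection in `S`,
finitely many members already exclude each piece, and the union of these finite families over `i`
excludes `S`. -/
theorem IsDescriptive.restrict (hF : F.IsDescriptive) {S : Set F.World} {hne : S.Nonempty}
    {hS : ∀ A ∈ F.Adm, ∀ B ∈ F.Adm, {w | ∀ v, w ≤ v → v ∈ S → v ∈ A → v ∈ B} ∈ F.Adm}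
    {ι : Type*} [Finite ι] {C D : ι → Set F.World} (hC : ∀ i, C i ∈ F.Adm)
    (hD : ∀ i, D i ∈ F.Adm) (hSCD : S = ⋃ i, C i \ D i) :
    (F.restrict S hne hS).IsDescriptive where
  refined w v hwv := by
    obtain ⟨A, hA, h₁, h₂⟩ := hF.refined w.1 v.1 hwv
    exact ⟨_, ⟨A, hA, rfl⟩, h₁, h₂⟩
  compact X hX Y hY h := by
    by_contra! hcon
    have key : ∀ i, ∃ X₀ ⊆ X, ∃ Y₀ ⊆ Y, X₀.Finite ∧ Y₀.Finite ∧
        ∀ w : S, w.1 ∈ C i → w.1 ∉ D i → (∀ A ∈ X₀, w ∈ A) → ∃ B ∈ Y₀, w ∈ B := by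
      intro i
      by_contra! hi
      -- Adding `C i` and `D i` confines the point found to the `i`-th piece.
      have := hF.compact (insert (C i) {A ∈ F.Adm | (Subtype.val : S → F.World) ⁻¹' A ∈ X})
        (Set.insert_subset (hC i) fun A hA => hA.1)
        (insert (D i) {A ∈ F.Adm | (Subtype.val : S → F.World) ⁻¹' A ∈ Y})
        (Set.insert_subset (hD i) fun A hA => hA.1) ?_
      · obtain ⟨w, hw₁, hw₂⟩ := this
        have hw : w ∈ S := by
          rw [hSCD]
          exact Set.mem_iUnion.2 ⟨i, hw₁ _ (Set.mem_insert _ _), hw₂ _ (Set.mem_insert _ _)⟩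
        obtain ⟨B, hB, hwB⟩ := hcon ⟨w, hw⟩ (by
          intro A hA
          obtain ⟨A, hA', rfl⟩ := hX hA
          exact hw₁ A (Or.inr ⟨hA', hA⟩))
        obtain ⟨B, hB', rfl⟩ := hY hB
        exact hw₂ B (Or.inr ⟨hB', hB⟩) hwB
      · intro X₀ hX₀ Y₀ hY₀ hXf hYf
        obtain ⟨w, hwC, hwD, hwX, hwY⟩ := hi
          ((fun A => (Subtype.val : S → F.World) ⁻¹' A) '' (X₀ \ {C i}))
          (by
            rintro _ ⟨A, ⟨hA, hAC⟩, rfl⟩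
            exact ((hX₀ hA).resolve_left hAC).2)
          ((fun A => (Subtype.val : S → F.World) ⁻¹' A) '' (Y₀ \ {D i}))
          (by
            rintro _ ⟨A, ⟨hA, hAC⟩, rfl⟩
            exact ((hY₀ hA).resolve_left hAC).2)
          (hXf.sdiff.image _) (hYf.sdiff.image _)
        refine ⟨w, fun A hA => ?_, fun B hB => ?_⟩
        · by_cases hAC : A = C i
          · exact hAC ▸ hwC
          · exact hwX _ ⟨A, ⟨hA, hAC⟩, rfl⟩
        · by_cases hBD : B = D i
          · exact hBD ▸ hwD
          · exact hwY _ ⟨B, ⟨hB, hBD⟩, rfl⟩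
    choose X₀ hX₀ Y₀ hY₀ hXf hYf hXY using key
    obtain ⟨w, hwX, hwY⟩ := h (⋃ i, X₀ i) (Set.iUnion_subset hX₀) (⋃ i, Y₀ i)
      (Set.iUnion_subset hY₀) (Set.finite_iUnion hXf) (Set.finite_iUnion hYf)
    have hw : w.1 ∈ ⋃ i, C i \ D i := hSCD ▸ w.2
    obtain ⟨i, hi⟩ := Set.mem_iUnion.1 hw
    obtain ⟨B, hB, hwB⟩ := hXY i w hi.1 hi.2 fun A hA => hwX A (Set.mem_iUnion.2 ⟨i, hA⟩)
    exact hwY B (Set.mem_iUnion.2 ⟨i, hB⟩) hwB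

/-- Implication from `A` to `B` relativized to `C i \ D i` is ordinary implication from `C i ∩ A` to
`D i ∪ B`; a finite intersection handles the union. -/
theorem relative_himp_mem {ι : Type*} [Finite ι] {C D : ι → Set F.World}
    (hC : ∀ i, C i ∈ F.Adm) (hD : ∀ i, D i ∈ F.Adm) :
    ∀ A ∈ F.Adm, ∀ B ∈ F.Adm,
      {w | ∀ v, w ≤ v → v ∈ ⋃ i, C i \ D i → v ∈ A → v ∈ B} ∈ F.Adm := by
  intro A hA B hB
  convert iInter_mem_adm fun i =>
    F.himp_mem _ (F.inter_mem _ (hC i) _ hA) _ (F.union_mem _ (hD i) _ hB) using 1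
  ext w
  simp only [Set.mem_iUnion, Set.mem_ofPred_eq, Set.mem_iInter]
  constructor
  · intro h i v hwv hv
    by_cases hvD : v ∈ D i
    · exact Or.inl hvD
    · exact Or.inr (h v hwv ⟨i, hv.1, hvD⟩ hv.2)
  · rintro h v hwv ⟨i, hvC, hvD⟩ hvA
    exact (h i v hwv ⟨hvC, hvA⟩).resolve_left hvD

end GeneralFrame

/-! ### Prime theories, the canonical frame and completeness -/

section Canonical

variable {α : Type u}

/-- Sets of formulas containing `L` and closed under modus ponens. -/
structure IsTheory (L T : Set (Formula α)) : Prop where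
  subset : L ⊆ T
  mp_mem : ∀ φ ψ, imp φ ψ ∈ T → φ ∈ T → ψ ∈ T

/-- Consistent theories with the disjunction property. -/
structure IsPrimeTheory (L T : Set (Formula α)) : Prop extends IsTheory L T where
  bot_notMem : bot ∉ T
  or_mem : ∀ φ ψ, Formula.or φ ψ ∈ T → φ ∈ T ∨ ψ ∈ T

theorem IsIntermediateLogic.isTheory_self {L : Set (Formula α)} (hL : IsIntermediateLogic L) :
    IsTheory L L :=
  ⟨subset_rfl, hL.mp_mem⟩

theorem IsTheory.mem_of_ipc {L T : Set (Formula α)} (hT : IsTheory L T)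
    (hL : IsIntermediateLogic L) {φ : Formula α} (h : IPC φ) : φ ∈ T :=
  hT.subset (hL.ipc_mem φ h)

theorem IsTheory.imp_mem {L T : Set (Formula α)} (hT : IsTheory L T)
    (hL : IsIntermediateLogic L) {φ ψ : Formula α} (h : ψ ∈ T) : imp φ ψ ∈ T :=
  hT.mp_mem _ _ (hT.mem_of_ipc hL (IPC.k ψ φ)) h

theorem IsTheory.imp_self_mem {L T : Set (Formula α)} (hT : IsTheory L T)
    (hL : IsIntermediateLogic L) (φ : Formula α) : imp φ φ ∈ T :=
  hT.mp_mem _ _ (hT.mp_mem _ _ (hT.mem_of_ipc hL (IPC.s φ (imp φ φ) φ))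
    (hT.mem_of_ipc hL (IPC.k φ (imp φ φ)))) (hT.mem_of_ipc hL (IPC.k φ φ))

/-- The theory generated by `T` and `φ`. -/
theorem IsTheory.adjoin {L T : Set (Formula α)} (hT : IsTheory L T)
    (hL : IsIntermediateLogic L) (φ : Formula α) : IsTheory L {ψ | imp φ ψ ∈ T} where
  subset _ hψ := hT.imp_mem hL (hT.subset hψ)
  mp_mem ψ χ h₁ h₂ := hT.mp_mem _ _ (hT.mp_mem _ _ (hT.mem_of_ipc hL (IPC.s φ ψ χ)) h₁) h₂

theorem IsTheory.exists_isPrimeTheory {L T : Set (Formula α)} (hT : IsTheory L T)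
    (hL : IsIntermediateLogic L) {χ : Formula α} (hχ : χ ∉ T) :
    ∃ P, IsPrimeTheory L P ∧ T ⊆ P ∧ χ ∉ P := by
  obtain ⟨P, hTP, hP⟩ := zorn_subset_nonempty {S | IsTheory L S ∧ χ ∉ S} (by
    intro c hc hchain hne
    refine ⟨⋃₀ c, ⟨⟨?_, ?_⟩, ?_⟩, fun s hs => Set.subset_sUnion_of_mem hs⟩
    · obtain ⟨s, hs⟩ := hne
      exact (hc hs).1.subset.trans (Set.subset_sUnion_of_mem hs)
    · rintro φ ψ ⟨s, hs, h₁⟩ ⟨t, ht, h₂⟩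
      rcases hchain.total hs ht with h | h
      · exact ⟨t, ht, (hc ht).1.mp_mem _ _ (h h₁) h₂⟩
      · exact ⟨s, hs, (hc hs).1.mp_mem _ _ h₁ (h h₂)⟩
    · rintro ⟨s, hs, h⟩
      exact (hc hs).2 h) T ⟨hT, hχ⟩
  -- By maximality, adjoining `φ` to `P` must yield `χ`; primeness then follows by case analysis.
  have key : ∀ φ, φ ∉ P → imp φ χ ∈ P := by
    intro φ hφ
    by_contra h
    exact hφ (hP.le_of_ge ⟨hP.prop.1.adjoin hL φ, h⟩ (fun ψ hψ => hP.prop.1.imp_mem hL hψ)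
      (hP.prop.1.imp_self_mem hL φ))
  refine ⟨P, ⟨hP.prop.1, fun h => ?_, fun φ ψ h => ?_⟩, hTP, hP.prop.2⟩
  · exact hP.prop.2 (hP.prop.1.mp_mem _ _ (hP.prop.1.mem_of_ipc hL (IPC.exFalso χ)) h)
  · by_contra! hcon
    exact hP.prop.2 (hP.prop.1.mp_mem _ _ (hP.prop.1.mp_mem _ _ (hP.prop.1.mp_mem _ _
      (hP.prop.1.mem_of_ipc hL (IPC.orElim φ ψ χ)) (key φ hcon.1)) (key ψ hcon.2)) h)

/-- The set of prime theories containing a given formula. -/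
def primeTheoriesWith (L : Set (Formula α)) (φ : Formula α) :
    Set {P : Set (Formula α) // IsPrimeTheory L P} :=
  {P | φ ∈ P.1}

section

variable {L : Set (Formula α)} {hL : IsIntermediateLogic L}

theorem primeTheoriesWith_bot : primeTheoriesWith L bot = ∅ :=
  Set.eq_empty_of_forall_notMem fun P => P.2.bot_notMem

theorem IsIntermediateLogic.primeTheoriesWith_and (hL : IsIntermediateLogic L)
    (φ ψ : Formula α) :
    primeTheoriesWith L (and φ ψ) = primeTheoriesWith L φ ∩ primeTheoriesWith L ψ := by
  ext P
  have hP := P.2.toIsTheory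
  exact ⟨fun h => ⟨hP.mp_mem _ _ (hP.mem_of_ipc hL (IPC.andLeft φ ψ)) h,
      hP.mp_mem _ _ (hP.mem_of_ipc hL (IPC.andRight φ ψ)) h⟩,
    fun h => hP.mp_mem _ _ (hP.mp_mem _ _ (hP.mem_of_ipc hL (IPC.andIntro φ ψ)) h.1) h.2⟩

theorem IsIntermediateLogic.primeTheoriesWith_or (hL : IsIntermediateLogic L)
    (φ ψ : Formula α) :
    primeTheoriesWith L (or φ ψ) = primeTheoriesWith L φ ∪ primeTheoriesWith L ψ := by
  ext P
  have hP := P.2.toIsTheory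
  exact ⟨fun h => P.2.or_mem φ ψ h,
    fun h => h.elim (hP.mp_mem _ _ (hP.mem_of_ipc hL (IPC.orLeft φ ψ)))
      (hP.mp_mem _ _ (hP.mem_of_ipc hL (IPC.orRight φ ψ)))⟩

theorem IsIntermediateLogic.primeTheoriesWith_imp (hL : IsIntermediateLogic L)
    (φ ψ : Formula α) :
    primeTheoriesWith L (imp φ ψ) =
      {P | ∀ Q, P ≤ Q → Q ∈ primeTheoriesWith L φ → Q ∈ primeTheoriesWith L ψ} := by
  ext P
  refine ⟨fun h Q hPQ hφ => Q.2.mp_mem _ _ (hPQ h) hφ, fun h => ?_⟩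
  by_contra hcon
  obtain ⟨Q, hQ, hPQ, hψ⟩ := (P.2.adjoin hL φ).exists_isPrimeTheory hL hcon
  exact hψ (h ⟨Q, hQ⟩ (fun χ hχ => hPQ (P.2.imp_mem hL hχ)) (hPQ (P.2.imp_self_mem hL φ)))

/-- The canonical frame of a consistent intermediate logic. -/
def canonicalFrame (L : Set (Formula α)) (hL : IsIntermediateLogic L)
    (hne : Nonempty {P : Set (Formula α) // IsPrimeTheory L P}) : GeneralFrame.{u} where
  World := {P : Set (Formula α) // IsPrimeTheory L P}
  order := inferInstance
  nonempty := hne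
  Adm := Set.range (primeTheoriesWith L)
  upper := by
    rintro _ ⟨φ, rfl⟩ P Q hPQ h
    exact hPQ h
  empty_mem := ⟨bot, primeTheoriesWith_bot⟩
  univ_mem := ⟨imp bot bot, Set.eq_univ_of_forall fun P => P.2.imp_self_mem hL bot⟩
  inter_mem := by
    rintro _ ⟨φ, rfl⟩ _ ⟨ψ, rfl⟩
    exact ⟨_, hL.primeTheoriesWith_and φ ψ⟩
  union_mem := by
    rintro _ ⟨φ, rfl⟩ _ ⟨ψ, rfl⟩
    exact ⟨_, hL.primeTheoriesWith_or φ ψ⟩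
  himp_mem := by
    rintro _ ⟨φ, rfl⟩ _ ⟨ψ, rfl⟩
    exact ⟨_, hL.primeTheoriesWith_imp φ ψ⟩

variable {hne : Nonempty {P : Set (Formula α) // IsPrimeTheory L P}}

/-- Every admissible valuation comes from a substitution `σ`. So this one truth lemma yields both
validity of `L`, by closure under substitution, and, for `σ = var`, refutation of non-theorems. -/
theorem sat_canonicalFrame (σ : α → Formula α) (φ : Formula α)
    (P : (canonicalFrame L hL hne).World) :
    Sat (fun p => primeTheoriesWith L (σ p)) P φ ↔ P ∈ primeTheoriesWith L (subst σ φ) := by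
  induction φ generalizing P with
  | bot => rw [subst, primeTheoriesWith_bot]; exact Iff.rfl
  | var p => exact Iff.rfl
  | and φ ψ ihφ ihψ =>
    rw [subst, hL.primeTheoriesWith_and]; exact and_congr (ihφ P) (ihψ P)
  | or φ ψ ihφ ihψ =>
    rw [subst, hL.primeTheoriesWith_or]; exact or_congr (ihφ P) (ihψ P)
  | imp φ ψ ihφ ihψ =>
    rw [subst, hL.primeTheoriesWith_imp]
    exact forall_congr' fun Q => imp_congr_right fun _ => imp_congr (ihφ Q) (ihψ Q)

theorem canonicalFrame_validates {φ : Formula α} (hφ : φ ∈ L) :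
    (canonicalFrame L hL hne).Validates φ := by
  intro V hV P
  choose σ hσ using hV
  obtain rfl : (fun p => primeTheoriesWith L (σ p)) = V := funext hσ
  exact (sat_canonicalFrame σ φ P).2 (P.2.subset (hL.subst_mem σ φ hφ))

theorem canonicalFrame_isDescriptive : (canonicalFrame L hL hne).IsDescriptive where
  refined P Q hPQ := by
    obtain ⟨φ, h₁, h₂⟩ := Set.not_subset.1 hPQ
    exact ⟨_, ⟨φ, rfl⟩, h₁, h₂⟩
  compact X hX Y hY h := by
    obtain ⟨U, hU⟩ := Ultrafilter.exists_ultrafilter_of_finite_inter_nonempty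
      (X ∪ compl '' Y) (by
        intro T hT
        obtain ⟨P, hP₁, hP₂⟩ := h (T ∩ X) Set.inter_subset_right
          (compl ⁻¹' (T : Set (Set (canonicalFrame L hL hne).World)) ∩ Y) Set.inter_subset_right
          (T.finite_toSet.inter_of_left X)
          ((T.finite_toSet.preimage compl_injective.injOn).inter_of_left Y)
        refine ⟨P, fun A hA => ?_⟩
        rcases hT hA with hAX | ⟨B, hB, rfl⟩
        · exact hP₁ A ⟨hA, hAX⟩
        · exact hP₂ B ⟨hA, hB⟩)
    -- The limit of the ultrafilter `U` is the theory of formulas true at `U`-almost all points.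
    refine ⟨⟨{φ | primeTheoriesWith L φ ∈ U}, ⟨⟨fun φ hφ => ?_, fun φ ψ h₁ h₂ => ?_⟩, ?_,
      fun φ ψ h => ?_⟩⟩, fun A hA => ?_, fun B hB => ?_⟩
    · exact Filter.mem_of_superset Filter.univ_mem fun P _ => P.2.subset hφ
    · exact Filter.mem_of_superset (Filter.inter_mem h₁ h₂)
        fun P hP => P.2.mp_mem _ _ hP.1 hP.2
    · rw [Set.mem_ofPred_eq, primeTheoriesWith_bot]
      exact Ultrafilter.empty_notMem
    · rw [Set.mem_ofPred_eq, hL.primeTheoriesWith_or] at h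
      exact Ultrafilter.union_mem_iff.1 h
    · obtain ⟨φ, rfl⟩ := hX hA
      exact hU (Or.inl hA)
    · obtain ⟨φ, rfl⟩ := hY hB
      exact Ultrafilter.compl_mem_iff_notMem.1 (hU (Or.inr ⟨_, hB, rfl⟩))

end

/-- Completeness: a formula outside `L` is refuted on a descriptive frame validating `L`. -/
theorem IsIntermediateLogic.exists_descriptive_refuting {L : Set (Formula α)}
    (hL : IsIntermediateLogic L) {φ : Formula α} (hφ : φ ∉ L) :
    ∃ F : GeneralFrame.{u}, F.IsDescriptive ∧ (∀ ψ ∈ L, F.Validates ψ) ∧ ¬ F.Validates φ := by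
  obtain ⟨P, hP, -, hφP⟩ := hL.isTheory_self.exists_isPrimeTheory hL hφ
  refine ⟨canonicalFrame L hL ⟨⟨P, hP⟩⟩, canonicalFrame_isDescriptive,
    fun ψ => canonicalFrame_validates, fun h => hφP ?_⟩
  have h' := (sat_canonicalFrame (hL := hL) (hne := ⟨⟨P, hP⟩⟩) var φ ⟨P, hP⟩).1
    (h _ (fun p => ⟨_, rfl⟩) _)
  have hsubst : ∀ ψ : Formula α, subst var ψ = ψ := by
    intro ψ
    induction ψ <;> simp_all [subst]
  rwa [hsubst] at h'

end Canonical

/-! ### Finite selection of witnesses -/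

section Selection

variable {α : Type u}

/-- The set of subformulas of a formula. -/
def Formula.subformulas : Formula α → Set (Formula α)
  | bot => {bot}
  | var p => {var p}
  | and φ ψ => insert (and φ ψ) (subformulas φ ∪ subformulas ψ)
  | or φ ψ => insert (or φ ψ) (subformulas φ ∪ subformulas ψ)
  | imp φ ψ => insert (imp φ ψ) (subformulas φ ∪ subformulas ψ)

theorem Formula.finite_subformulas (φ : Formula α) : φ.subformulas.Finite := by
  induction φ with
  | bot => exact Set.finite_singleton _
  | var p => exact Set.finite_singleton _
  | and φ ψ ihφ ihψ => exact (ihφ.union ihψ).insert _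
  | or φ ψ ihφ ihψ => exact (ihφ.union ihψ).insert _
  | imp φ ψ ihφ ihψ => exact (ihφ.union ihψ).insert _

theorem Formula.mem_subformulas_self (φ : Formula α) : φ ∈ φ.subformulas := by
  cases φ <;> simp [subformulas]

/-- Every world `x` of a model is the image of the root of a finite poset under a monotone map
such that refuted implications from the finite set `S` have witnesses inside the poset. -/
theorem Persistent.exists_finite_selection {W : Type u} [PartialOrder W] {V : α → Set W}
    (hV : Persistent V) {S : Set (Formula α)} (hS : S.Finite) (x : W) :
    ∃ (T : Type u) (_ : PartialOrder T) (_ : Finite T) (f : T → W) (r : T),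
      Monotone f ∧ (∀ t, r ≤ t) ∧ f r = x ∧
      ∀ φ ψ, imp φ ψ ∈ S → ∀ t, ¬ Sat V (f t) (imp φ ψ) →
        ∃ s, t ≤ s ∧ Sat V (f s) φ ∧ ¬ Sat V (f s) ψ := by
  let S' : Set (Formula α) := {φ | ∃ ψ, imp φ ψ ∈ S}
  have hS' : S'.Finite := by
    refine (hS.image (fun χ => match χ with | imp φ _ => φ | _ => bot)).subset ?_
    rintro φ ⟨ψ, h⟩
    exact ⟨_, h, rfl⟩
  have hfin : ∀ y : W, (S' ∩ {φ | ¬ Sat V y φ}).Finite := fun y => hS'.inter_of_left _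
  -- The measure counts antecedents of implications in `S` that fail at `x`. It drops on passing to
  -- a witness `y i`, where one more antecedent holds.
  induction hn : (S' ∩ {φ | ¬ Sat V x φ}).ncard using Nat.strong_induction_on generalizing x with
  | _ n ih =>
  let I := {χ : Formula α × Formula α // imp χ.1 χ.2 ∈ S ∧ ¬ Sat V x (imp χ.1 χ.2) ∧
    ¬ Sat V x χ.1}
  have : Finite I := by
    refine Set.Finite.to_subtype (Set.Finite.subset (hS.preimage
      (f := fun χ : Formula α × Formula α => imp χ.1 χ.2) ?_) fun χ h => h.1)
    rintro ⟨a, b⟩ _ ⟨c, d⟩ _ h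
    simpa using h
  have step : ∀ i : I, ∃ y, x ≤ y ∧ Sat V y i.1.1 ∧ ¬ Sat V y i.1.2 := by
    intro i
    have := i.2.2.1
    simp only [Sat] at this
    push Not at this
    exact this
  choose y hxy hy₁ hy₂ using step
  have hrec := fun i : I => ih _ (by
    rw [← hn]
    refine Set.ncard_lt_ncard ⟨fun φ hφ => ⟨hφ.1, fun h => hφ.2 (hV.sat_mono (hxy i) h)⟩,
      fun h => ?_⟩ (hfin x)
    exact (h ⟨⟨_, i.2.1⟩, i.2.2.2⟩ : i.1.1 ∈ S' ∩ {φ | ¬ Sat V (y i) φ}).2 (hy₁ i)) (y i) rfl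
  choose T o hT f r hf hr hfr hfS using hrec
  -- The recursively built posets are placed side by side above a new root sent to `x`.
  refine ⟨WithBot (Σ i, T i), inferInstance, inferInstanceAs (Finite (Option (Σ i, T i))),
    WithBot.recBotCoe x (fun s => f s.1 s.2), ⊥, ?_, fun t => bot_le, rfl, ?_⟩
  · intro s t hst
    induction s with
    | bot =>
      induction t with
      | bot => exact le_rfl
      | coe t => exact (hxy t.1).trans ((hfr t.1).symm.le.trans (hf t.1 (hr t.1 t.2)))
    | coe s =>
      induction t with
      | bot => simp at hst
      | coe t =>
        obtain ⟨i, s, t, hst⟩ := WithBot.coe_le_coe.1 hst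
        exact hf i (by assumption)
  · intro φ ψ hS t ht
    induction t with
    | bot =>
      -- When the antecedent already holds at `x`, the root is its own witness; that is why `I`
      -- omits such implications.
      by_cases hφ : Sat V x φ
      · by_cases hψ : Sat V x ψ
        · exact (ht fun v hv _ => hV.sat_mono hv hψ).elim
        · exact ⟨⊥, le_rfl, hφ, hψ⟩
      · let i : I := ⟨(φ, ψ), hS, ht, hφ⟩
        refine ⟨((⟨i, r i⟩ : Σ i, T i) : WithBot _), bot_le, ?_, ?_⟩
        · change Sat V (f i (r i)) φ
          rw [hfr]
          exact hy₁ i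
        · change ¬ Sat V (f i (r i)) ψ
          rw [hfr]
          exact hy₂ i
    | coe t =>
      obtain ⟨s, hts, h⟩ := hfS t.1 φ ψ hS t.2 ht
      refine ⟨((⟨t.1, s⟩ : Σ i, T i) : WithBot _), ?_, ?_⟩
      · exact WithBot.coe_le_coe.2 (Sigma.LE.fiber t.1 t.2 s hts)
      · exact h

end Selection

/-! ### Refutation of subframe formulas as simulation -/

section Beta

variable {α : Type u} {T : Type u} [PartialOrder T] {vars : Finset α} {U : α → Set T}

theorem exists_isBeta [Finite T] (vars : Finset α) (U : α → Set T) (t : T) :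
    ∃ φ, IsBeta vars U t φ := by
  classical
  induction t using (wellFounded_gt (α := T)).induction with
  | _ t ih =>
  let ps := (vars.filter fun p => t ∈ U p).toList
  let qs := (vars.filter fun p => t ∉ U p).toList
  have hps : ps.Nodup ∧ ∀ p, p ∈ ps ↔ p ∈ vars ∧ t ∈ U p := ⟨Finset.nodup_toList _, by simp [ps]⟩
  have hqs : qs.Nodup ∧ ∀ p, p ∈ qs ↔ p ∈ vars ∧ t ∉ U p := ⟨Finset.nodup_toList _, by simp [qs]⟩
  by_cases hmax : IsMax t
  · exact ⟨_, IsBeta.maximal t ps qs hps hqs hmax⟩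
  · choose b hb using ih
    refine ⟨_, IsBeta.notMaximal t ps qs (Set.toFinite {v | t ⋖ v}).toFinset.toList
      -- The value `bot` is a dummy: only immediate successors of `t` are used.
      (fun v => if h : t < v then b v h else bot) hps hqs
      ⟨Finset.nodup_toList _, by simp⟩ hmax fun v hv => ?_⟩
    have hv : t < v := CovBy.lt (by simpa using hv)
    simpa only [dif_pos hv] using hb v hv

variable {W : Type u} [PartialOrder W] {V : α → Set W}

/-- `Simulates vars U V t z`: starting from `z`, the part of the model `(T, U)` above `t` can be
followed along immediate successors, with the same variables from `vars` true. -/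
inductive Simulates (vars : Finset α) (U : α → Set T) (V : α → Set W) : T → W → Prop
  | intro (t : T) (z : W) (g : T → W) (hcolor : ∀ p ∈ vars, t ∈ U p ↔ z ∈ V p)
      (hle : ∀ s, t ⋖ s → z ≤ g s) (hg : ∀ s, t ⋖ s → Simulates vars U V s (g s)) :
      Simulates vars U V t z

theorem simulates_iff {t : T} {z : W} : Simulates vars U V t z ↔
    (∀ p ∈ vars, t ∈ U p ↔ z ∈ V p) ∧ ∀ s, t ⋖ s → ∃ y, z ≤ y ∧ Simulates vars U V s y := by
  constructor
  · rintro ⟨_, _, g, hcolor, hle, hg⟩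
    exact ⟨hcolor, fun s hs => ⟨g s, hle s hs, hg s hs⟩⟩
  · rintro ⟨hcolor, h⟩
    have : ∀ s, ∃ y, t ⋖ s → z ≤ y ∧ Simulates vars U V s y := by
      intro s
      by_cases hs : t ⋖ s
      · obtain ⟨y, hy⟩ := h s hs
        exact ⟨y, fun _ => hy⟩
      · exact ⟨z, fun h => (hs h).elim⟩
    choose g hg using this
    exact ⟨t, z, g, hcolor, fun s hs => (hg s hs).1, fun s hs => (hg s hs).2⟩

/-- In a finite poset `s` is reached from `t` by a chain of covers, each followed by one step of the
simulation. -/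
theorem Simulates.exists_of_le [Finite T] {t s : T} {z : W} (h : Simulates vars U V t z)
    (hts : t ≤ s) : ∃ y, z ≤ y ∧ Simulates vars U V s y := by
  induction t using (wellFounded_gt (α := T)).induction generalizing z with
  | _ t ih =>
  rcases hts.eq_or_lt with rfl | hlt
  · exact ⟨z, le_rfl, h⟩
  · obtain ⟨v, hv, hvs⟩ := exists_covBy_le_of_lt hlt
    obtain ⟨y, hzy, hy⟩ := (simulates_iff.1 h).2 v hv
    obtain ⟨y', hy', h'⟩ := ih v hv.lt hy hvs
    exact ⟨y', hzy.trans hy', h'⟩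

theorem Monotone.simulates [Finite T] {f : T → W} (hf : Monotone f)
    (hcolor : ∀ p ∈ vars, ∀ t, t ∈ U p ↔ f t ∈ V p) (t : T) : Simulates vars U V t (f t) := by
  induction t using (wellFounded_gt (α := T)).induction with
  | _ t ih =>
  exact ⟨t, f t, f, fun p hp => hcolor p hp t, fun s hs => hf hs.le, fun s hs => ih s hs.lt⟩

/-- A refutation of `β(t)` is a point above `x` with exactly the colours of `t` at which every
`β(s)`, for `s` covering `t`, fails; recursively, each failure gives a simulation of `s` further up.
-/
theorem IsBeta.not_sat_iff (hV : Persistent V) {t : T} {φ : Formula α} (h : IsBeta vars U t φ)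
    (x : W) : ¬ Sat V x φ ↔ ∃ y, x ≤ y ∧ Simulates vars U V t y := by
  have hcolor : ∀ {t : T} {ps qs : List α} {y : W},
      (ps.Nodup ∧ ∀ p, p ∈ ps ↔ p ∈ vars ∧ t ∈ U p) →
      (qs.Nodup ∧ ∀ p, p ∈ qs ↔ p ∈ vars ∧ t ∉ U p) →
      (((∀ p ∈ ps, y ∈ V p) ∧ ∀ q ∈ qs, y ∉ V q) ↔ ∀ p ∈ vars, t ∈ U p ↔ y ∈ V p) := by
    intro t ps qs y hps hqs
    refine ⟨fun ⟨h₁, h₂⟩ p hp => ⟨fun h => h₁ p ((hps.2 p).2 ⟨hp, h⟩), fun h => ?_⟩,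
      fun h => ⟨fun p hp => ?_, fun q hq => ?_⟩⟩
    · by_contra hcon
      exact h₂ p ((hqs.2 p).2 ⟨hp, hcon⟩) h
    · obtain ⟨h₁, h₂⟩ := (hps.2 p).1 hp
      exact (h p h₁).1 h₂
    · obtain ⟨h₁, h₂⟩ := (hqs.2 q).1 hq
      exact fun h' => h₂ ((h q h₁).2 h')
  induction h generalizing x with
  | maximal t ps qs hps hqs hmax =>
    rw [hV.sat_bigAndImp]
    push Not
    refine exists_congr fun y => and_congr_right fun _ => ?_
    rw [simulates_iff, ← hcolor hps hqs, sat_bigOr]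
    have : ∀ s, t ⋖ s → ∃ z, y ≤ z ∧ Simulates vars U V s z :=
      fun s hs => (hmax.not_lt hs.lt).elim
    rw [and_iff_left this]
    simp [Sat]
  | notMaximal t ps qs ws b hps hqs hws hmax hb ih =>
    rw [hV.sat_bigAndImp]
    push Not
    refine exists_congr fun y => and_congr_right fun _ => ?_
    have hsucc : (∀ s, t ⋖ s → ∃ z, y ≤ z ∧ Simulates vars U V s z) ↔
        ∀ v ∈ ws, ¬ Sat V y (b v) :=
      forall_congr' fun s => by
        rw [hws.2]
        exact forall_congr' fun hs => (ih s ((hws.2 s).2 hs) y).symm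
    rw [simulates_iff, ← hcolor hps hqs, hsucc]
    simp [Sat, sat_bigOr, and_assoc]

end Beta

/-! ### Subframe logics are axiomatized by their `B`-formulas -/

section Subframes

variable {α : Type u}

/-- If the colours of a finite model code a refutation of `φ` and the subframe formula of its root
is not in the subframe logic `L`, then `φ` is not in `L` either. -/
theorem IsSubframeLogic.notMem_of_isBeta_notMem {L : Set (Formula α)} (hL : IsSubframeLogic L)
    {T W : Type u} [PartialOrder T] [Finite T] [PartialOrder W] {V : α → Set W} {f : T → W}
    {φ β : Formula α} {r : T} {vars : Finset α} {U : α → Set T} {c : Formula α → α}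
    (hvars : ∀ ψ ∈ φ.subformulas, c ψ ∈ vars)
    (hU : ∀ ψ ∈ φ.subformulas, ∀ t, t ∈ U (c ψ) ↔ Sat V (f t) ψ)
    (hwit : ∀ ψ χ, imp ψ χ ∈ φ.subformulas → ∀ t, ¬ Sat V (f t) (imp ψ χ) →
      ∃ s, t ≤ s ∧ Sat V (f s) ψ ∧ ¬ Sat V (f s) χ)
    (hr : ¬ Sat V (f r) φ) (hβ : IsBeta vars U r β) (hβL : β ∉ L) : φ ∉ L := by
  intro hφ
  obtain ⟨G, hG, hGL, hGβ⟩ := hL.1.exists_descriptive_refuting hβL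
  simp only [GeneralFrame.Validates, not_forall] at hGβ
  obtain ⟨V', hV', y, hy⟩ := hGβ
  have hpers := G.persistent hV'
  obtain ⟨z₀, -, hz₀⟩ := (hβ.not_sat_iff hpers y).1 hy
  choose b hb using exists_isBeta vars U
  -- `C t \ D t` is the set of points simulating `t`: membership in `D t` means having a colour that
  -- `t` lacks or satisfying `β` of some immediate successor.
  let C : T → Set G.World := fun t => ⋂ p : {p : vars // t ∈ U p.1}, V' p.1
  let D : T → Set G.World := fun t =>
    (⋃ p : {p : vars // t ∉ U p.1}, V' p.1) ∪ ⋃ s : {s // t ⋖ s}, {w | Sat V' w (b s)}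
  have hC : ∀ t, C t ∈ G.Adm := fun t => GeneralFrame.iInter_mem_adm fun p => hV' _
  have hD : ∀ t, D t ∈ G.Adm := fun t => G.union_mem _
    (GeneralFrame.iUnion_mem_adm fun p => hV' _) _
    (GeneralFrame.iUnion_mem_adm fun s => G.sat_mem_adm hV' _)
  have hCD : ∀ t z, z ∈ C t \ D t ↔ Simulates vars U V' t z := by
    intro t z
    rw [simulates_iff]
    have hsucc : (∀ s, t ⋖ s → ∃ y, z ≤ y ∧ Simulates vars U V' s y) ↔
        ∀ s, t ⋖ s → ¬ Sat V' z (b s) :=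
      forall_congr' fun s => forall_congr' fun hs => ((hb s).not_sat_iff hpers z).symm
    rw [hsucc]
    simp only [C, D, Set.mem_sdiff, Set.mem_iInter, Set.mem_union, Set.mem_iUnion, Subtype.forall,
      Subtype.exists, Set.mem_ofPred_eq, not_or, not_exists, exists_prop, not_and]
    grind
  let Z : Set G.World := ⋃ t, C t \ D t
  have hZ : ∀ z, z ∈ Z ↔ ∃ t, Simulates vars U V' t z := by simp [Z, ← hCD]
  have hsub := GeneralFrame.relative_himp_mem hC hD
  let G' := G.restrict Z ⟨z₀, (hZ z₀).2 ⟨r, hz₀⟩⟩ hsub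
  have hG' : G'.IsDescriptive := hG.restrict hC hD rfl
  have hval : G'.Validates φ :=
    hL.2 G G' (Or.inr ⟨hG, hG'⟩) (G.restrict_isSubframe _ _ _) hGL φ hφ
  let Vr : α → Set G'.World := fun p => Subtype.val ⁻¹' V' (c (var p))
  have hcol : ∀ {t z}, Simulates vars U V' t z → ∀ ψ ∈ φ.subformulas,
      (z ∈ V' (c ψ) ↔ Sat V (f t) ψ) := fun h ψ hψ =>
    ((simulates_iff.1 h).1 _ (hvars ψ hψ)).symm.trans (hU ψ hψ _)
  -- Truth lemma on the subframe: a point simulating `t` carries the colour of `ψ` exactly when `ψ`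
  -- holds at `f t`.
  have key : ∀ ψ, ψ.subformulas ⊆ φ.subformulas → ∀ z : G'.World,
      Sat Vr z ψ ↔ z.1 ∈ V' (c ψ) := by
    intro ψ hψ z
    have hself := hψ ψ.mem_subformulas_self
    obtain ⟨t, ht⟩ := (hZ z.1).1 z.2
    have htψ := hcol ht ψ hself
    induction ψ generalizing z t with
    | bot => exact htψ.symm
    | var p => exact Iff.rfl
    | and ψ χ ihψ ihχ =>
      have h₁ := (Set.subset_union_left.trans (Set.subset_insert _ _)).trans hψ
      have h₂ := (Set.subset_union_right.trans (Set.subset_insert _ _)).trans hψ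
      have h₁' := h₁ ψ.mem_subformulas_self
      have h₂' := h₂ χ.mem_subformulas_self
      rw [htψ]
      exact and_congr ((ihψ h₁ z h₁' t ht (hcol ht ψ h₁')).trans (hcol ht ψ h₁'))
        ((ihχ h₂ z h₂' t ht (hcol ht χ h₂')).trans (hcol ht χ h₂'))
    | or ψ χ ihψ ihχ =>
      have h₁ := (Set.subset_union_left.trans (Set.subset_insert _ _)).trans hψ
      have h₂ := (Set.subset_union_right.trans (Set.subset_insert _ _)).trans hψ
      have h₁' := h₁ ψ.mem_subformulas_self
      have h₂' := h₂ χ.mem_subformulas_self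
      rw [htψ]
      exact or_congr ((ihψ h₁ z h₁' t ht (hcol ht ψ h₁')).trans (hcol ht ψ h₁'))
        ((ihχ h₂ z h₂' t ht (hcol ht χ h₂')).trans (hcol ht χ h₂'))
    | imp ψ χ ihψ ihχ =>
      have h₁ := (Set.subset_union_left.trans (Set.subset_insert _ _)).trans hψ
      have h₂ := (Set.subset_union_right.trans (Set.subset_insert _ _)).trans hψ
      have h₁' := h₁ ψ.mem_subformulas_self
      have h₂' := h₂ χ.mem_subformulas_self
      constructor
      · intro hz
        by_contra hcon
        -- The selected witness `s` above `t` is matched by a point of the subframe above `z`.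
        obtain ⟨s, hts, hs₁, hs₂⟩ := hwit ψ χ hself t (fun h => hcon (htψ.2 h))
        obtain ⟨y, hzy, hy⟩ := ht.exists_of_le hts
        let y' : G'.World := ⟨y, (hZ y).2 ⟨s, hy⟩⟩
        have hy₁ : Sat Vr y' ψ :=
          (ihψ h₁ y' h₁' s hy (hcol hy ψ h₁')).2 ((hcol hy ψ h₁').2 hs₁)
        exact hs₂ ((hcol hy χ h₂').1 ((ihχ h₂ y' h₂' s hy (hcol hy χ h₂')).1
          (hz y' hzy hy₁)))
      · intro hz y hzy hy
        obtain ⟨s, hs⟩ := (hZ y.1).1 y.2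
        have hs₁ := (hcol hs ψ h₁').1 ((ihψ h₁ y h₁' s hs (hcol hs ψ h₁')).1 hy)
        -- The colour of the implication persists from `z` to `y`, so the implication holds at `f s`
        -- itself.
        have hs₂ := (hcol hs _ hself).1 (hpers _ hzy hz)
        exact (ihχ h₂ y h₂' s hs (hcol hs χ h₂')).2
          ((hcol hs χ h₂').2 (hs₂ _ le_rfl hs₁))
  have hz := (key φ subset_rfl ⟨z₀, (hZ z₀).2 ⟨r, hz₀⟩⟩).1
    (hval Vr (fun p => ⟨_, hV' _, rfl⟩) _)
  exact hr ((hcol hz₀ φ φ.mem_subformulas_self).1 hz)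

theorem IsSubframeLogic.axiomatizableBy_bFormulas [Infinite α] {L : Set (Formula α)}
    (hL : IsSubframeLogic L) : AxiomatizableBy (BFormulas α) L := by
  refine ⟨BFormulas α ∩ L, Set.inter_subset_left, ⟨hL.1, Set.inter_subset_right⟩, ?_⟩
  rintro L' ⟨hL', hsub⟩ φ hφ
  by_contra hφL'
  obtain ⟨F, -, hFL', hFφ⟩ := hL'.exists_descriptive_refuting hφL'
  simp only [GeneralFrame.Validates, not_forall] at hFφ
  obtain ⟨V, hV, x, hx⟩ := hFφ
  obtain ⟨T, _, _, f, r, hf, -, rfl, hwit⟩ :=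
    (F.persistent hV).exists_finite_selection φ.finite_subformulas x
  -- Infinitely many variables leave room to name each subformula by its own variable.
  obtain ⟨c, hc⟩ : ∃ c : Formula α → α, Set.InjOn c φ.subformulas := by
    obtain ⟨c, -, hc⟩ := φ.finite_subformulas.exists_injOn_of_encard_le
      (t := (Set.univ : Set α)) (by simp [Set.infinite_univ.encard_eq])
    exact ⟨c, hc⟩
  have : Nonempty (Formula α) := ⟨bot⟩
  let σ : α → Formula α := Function.invFunOn c φ.subformulas
  have hσ : ∀ ψ ∈ φ.subformulas, σ (c ψ) = ψ := fun ψ hψ => hc.leftInvOn_invFunOn hψ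
  let V' : α → Set F.World := fun p => {w | Sat V w (σ p)}
  have hV' : ∀ p, V' p ∈ F.Adm := fun p => F.sat_mem_adm hV _
  let vars : Finset α := (φ.finite_subformulas.image c).toFinset
  obtain ⟨β, hβ⟩ := exists_isBeta vars (fun p => f ⁻¹' V' p) r
  refine hL.notMem_of_isBeta_notMem (fun ψ hψ => by simpa [vars] using ⟨ψ, hψ, rfl⟩)
    (fun ψ hψ t => ?_) hwit hx hβ (fun hβL => ?_) hφ
  · rw [Set.mem_preimage, Set.mem_ofPred_eq, hσ ψ hψ]
  · have hβB : β ∈ BFormulas α := ⟨vars, T, _, inferInstance, _, r,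
      fun p _ _ hst hs => F.persistent hV' p (hf hst) hs, hβ⟩
    -- The coloured poset is simulated along `f`, so `β` fails at `f r`; were it in `L`, it would be
    -- in `L'` and valid on `F`.
    exact (hβ.not_sat_iff (F.persistent hV') (f r)).2
      ⟨f r, le_rfl, hf.simulates (fun _ _ _ => Iff.rfl) r⟩ (hFL' β (hsub ⟨hβB, hβL⟩) V' hV' _)

end Subframes

/-! ### From `B` to NNIL to MR, and from MR to subframe logics -/

section Inclusions

variable {α : Type u}

theorem AxiomatizableBy.mono {Φ Ψ L : Set (Formula α)} (h : Φ ⊆ Ψ)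
    (hL : AxiomatizableBy Φ L) : AxiomatizableBy Ψ L :=
  let ⟨Γ, hΓ, hL⟩ := hL
  ⟨Γ, hΓ.trans h, hL⟩

theorem IsNNIL.bigOr {l : List (Formula α)} (h : ∀ φ ∈ l, IsNNIL φ) : IsNNIL (bigOr l) := by
  induction l with
  | nil => exact IsNNIL.bot
  | cons φ l ih =>
    cases l with
    | nil => exact h φ (by simp)
    | cons ψ l => exact IsNNIL.or _ _ (h φ (by simp)) (ih fun χ hχ => h χ (by simp [hχ]))

theorem ImpFree.bigAnd {φ : Formula α} {l : List (Formula α)} (h : ∀ ψ ∈ φ :: l, ImpFree ψ) :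
    ImpFree (bigAnd φ l) := by
  induction l generalizing φ with
  | nil => exact h φ (by simp)
  | cons ψ l ih => exact ImpFree.and _ _ (h φ (by simp)) (ih fun χ hχ => h χ (by simp [hχ]))

theorem IsNNIL.bigAndImp {l : List (Formula α)} {χ : Formula α} (h : ∀ φ ∈ l, ImpFree φ)
    (hχ : IsNNIL χ) : IsNNIL (bigAndImp l χ) := by
  cases l with
  | nil => exact hχ
  | cons φ l => exact IsNNIL.imp _ _ (ImpFree.bigAnd h) hχ

theorem IsBeta.isNNIL {W : Type u} [PartialOrder W] {vars : Finset α} {V : α → Set W} {w : W}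
    {φ : Formula α} (h : IsBeta vars V w φ) : IsNNIL φ := by
  have hvar : ∀ (l : List α), ∀ φ ∈ l.map var, IsNNIL φ := by
    intro l φ hφ
    obtain ⟨p, -, rfl⟩ := List.mem_map.1 hφ
    exact IsNNIL.var p
  have hvar' : ∀ (l : List α), ∀ φ ∈ l.map var, ImpFree φ := by
    intro l φ hφ
    obtain ⟨p, -, rfl⟩ := List.mem_map.1 hφ
    exact ImpFree.var p
  induction h with
  | maximal w ps qs hps hqs hmax =>
    exact IsNNIL.bigAndImp (hvar' ps) (IsNNIL.bigOr (hvar qs))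
  | notMaximal w ps qs ws b hps hqs hws hmax hb ih =>
    refine IsNNIL.bigAndImp (hvar' ps) (IsNNIL.or _ _ (IsNNIL.bigOr (hvar qs)) (IsNNIL.bigOr ?_))
    intro φ hφ
    obtain ⟨v, hv, rfl⟩ := List.mem_map.1 hφ
    exact ih v hv

theorem ImpFree.sat_iff {W W' : Type u} [PartialOrder W] [PartialOrder W'] {V : α → Set W}
    {V' : α → Set W'} {f : W → W'} (hf : ∀ p w, w ∈ V p ↔ f w ∈ V' p) {φ : Formula α}
    (h : ImpFree φ) (w : W) : Sat V w φ ↔ Sat V' (f w) φ := by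
  induction h with
  | bot => exact Iff.rfl
  | var p => exact hf p w
  | and φ ψ _ _ ihφ ihψ => exact and_congr ihφ ihψ
  | or φ ψ _ _ ihφ ihψ => exact or_congr ihφ ihψ

/-- Implication-free antecedents have the same truth value at `v` and `f v`, so they can be pushed
forward along `f` and the consequent pulled back. -/
theorem IsNNIL.isMR {φ : Formula α} (h : IsNNIL φ) : IsMR φ := by
  intro W W' _ _ V V' _ _ f hmono hf w hw
  induction h generalizing w with
  | bot => exact hw
  | var p => exact (hf p w).2 hw
  | and φ ψ _ _ ihφ ihψ => exact ⟨ihφ w hw.1, ihψ w hw.2⟩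
  | or φ ψ _ _ ihφ ihψ => exact hw.imp (ihφ w) (ihψ w)
  | imp φ ψ hφ _ ihψ =>
    exact fun v hwv hv => ihψ v (hw (f v) (hmono hwv) ((hφ.sat_iff hf v).1 hv))

theorem IsMR.validates_of_isSubframe {φ : Formula α} (h : IsMR φ) {F F' : GeneralFrame.{u}}
    (hF : F'.IsSubframe F) (hφ : F.Validates φ) : F'.Validates φ := by
  obtain ⟨e, hAdm, -⟩ := hF
  intro V hV w
  have hV' : ∀ p, ∃ A ∈ F.Adm, V p = e ⁻¹' A := fun p => by
    have := hV p
    rwa [hAdm] at this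
  choose V' hV' hVV' using hV'
  exact h _ _ V V' (F'.persistent hV) (F.persistent hV') e e.monotone
    (fun p w => by rw [hVV' p]; exact Iff.rfl) w (hφ V' hV' _)

theorem AxiomatizableBy.isSubframeLogic {L : Set (Formula α)}
    (h : AxiomatizableBy {φ | IsMR φ} L) : IsSubframeLogic L := by
  obtain ⟨Γ, hΓ, ⟨hL, hΓL⟩, hleast⟩ := h
  refine ⟨hL, fun F F' _ hF hval => ?_⟩
  -- The formulas valid on `F'` form an intermediate logic containing `Γ`, hence `L`.
  exact hleast ⟨F'.isIntermediateLogic_validates,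
    fun φ hφ => IsMR.validates_of_isSubframe (hΓ hφ) hF (hval φ (hΓL hφ))⟩

end Inclusions

/-- For an intermediate logic, being axiomatizable by `B`-formulas, by NNIL-formulas, by
MR-formulas, and being a subframe logic are equivalent. -/
theorem corollary4p10 {α : Type u} [Infinite α] (L : Set (Formula α))
    (hL : IsIntermediateLogic L) :
    List.TFAE
      [AxiomatizableBy (BFormulas α) L,
        AxiomatizableBy {φ | IsNNIL φ} L,
        AxiomatizableBy {φ | IsMR φ} L,
        IsSubframeLogic L] := by
  tfae_have 1 → 2 := AxiomatizableBy.mono fun φ ⟨_, _, _, _, _, _, _, h⟩ => h.isNNIL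
  tfae_have 2 → 3 := AxiomatizableBy.mono fun φ h => IsNNIL.isMR h
  tfae_have 3 → 4 := AxiomatizableBy.isSubframeLogic
  tfae_have 4 → 1 := IsSubframeLogic.axiomatizableBy_bFormulas
  tfae_finish
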